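/- Let $d \ge 1$ and let $\mathcal{M}$ be the set of all Radon measures on $\mathbb{R}^d$, equipped with the weak topology, that is, the coarsest topology for which $\mu \mapsto \int \phi \, d\mu$ is continuous for every compactly supported continuous $\phi : \mathbb{R}^d \to \mathbb{R}$. Write $B(x,r)$ for the closed Euclidean ball with center $x$ and radius $r$. Say that $\mu \in \mathcal{M}$ satisfies the doubling condition at $x \in \mathbb{R}^d$ if $$\limsup_{r \to 0^+} \frac{\mu(B(x,2r))}{\mu(B(x,r))} < \infty,$$ and that $\mu$ is non-doubling if the doubling condition fails, that is, this upper limit equals $\infty$, at $\mu$-almost every $x \in \mathbb{R}^d$. Then a typical measure $\mu \in \mathcal{M}$ is non-doubling: the set of all $\mu \in \mathcal{M}$ that are not non-doubling is meagre in $\mathcal{M}$, i.e. it is a countable union of sets whose closures in $\mathcal{M}$ have empty interior. -/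

import Mathlib

open MeasureTheory Filter Topology
open scoped ENNReal CompactlySupported

/-- A Radon measure on Euclidean space `ℝ^d`: a Borel measure that is finite on compact sets,
outer regular, and inner regular on open sets with respect to compact sets. -/
@[ext]
structure RadonMeasure (d : ℕ) where
  toMeasure : Measure (EuclideanSpace ℝ (Fin d))
  regular : toMeasure.Regular

namespace RadonMeasure

/-- The weak topology on Radon measures: the coarsest topology for which `μ ↦ ∫ φ dμ` is
continuous for every continuous compactly supported `φ : ℝ^d → ℝ`. -/
noncomputable instance instTopologicalSpace (d : ℕ) : TopologicalSpace (RadonMeasure d) :=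
  TopologicalSpace.induced
    (fun (μ : RadonMeasure d) (φ : C_c(EuclideanSpace ℝ (Fin d), ℝ)) => ∫ x, φ x ∂μ.toMeasure)
    inferInstance

/-- The doubling condition for `μ` at `x`:
`limsup_{r → 0+} μ(B(x,2r)) / μ(B(x,r)) < ∞`, with closed Euclidean balls. The quotient is taken
in `[0, ∞]`; both balls have finite measure, and the denominator is positive whenever `x` is in
the support of `μ`, hence for `μ`-almost every `x`. -/
def DoublingAt {d : ℕ} (μ : RadonMeasure d) (x : EuclideanSpace ℝ (Fin d)) : Prop :=
  limsup (fun r : ℝ =>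
    μ.toMeasure (Metric.closedBall x (2 * r)) / μ.toMeasure (Metric.closedBall x r))
    (𝓝[>] (0 : ℝ)) < ∞

/-- `μ` is non-doubling if the doubling condition fails at `μ`-almost every point. -/
def NonDoubling {d : ℕ} (μ : RadonMeasure d) : Prop :=
  ∀ᵐ x ∂μ.toMeasure, ¬ μ.DoublingAt x

end RadonMeasure

/-- A property holds for typical points of a space if the set of points with this property is
residual, that is, if its complement is meagre: a countable union of nowhere dense sets. -/
def IsTypical {X : Type*} [TopologicalSpace X] (P : X → Prop) : Prop :=
  IsMeagre {x | P x}ᶜ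

/-! Doubling points lie in the increasing sets `slowSet μ N`. If the part of `slowSet μ N` in the
ball of radius `N` has mass below `1 / (N + 1)` for every `N`, monotonicity makes all these parts
null and `μ` is non-doubling. So it suffices that each of these mass conditions holds on a dense
open set.

Finite atomic measures are dense. Split each atom into `M + 2N + 1` equal atoms of mass `w` at `x +
θ 4⁻ʲ e`, a weakly small change as `θ → 0`. At scale `s = θ 4⁻ʲ` the ball of radius `0.7 s` about
the `j`-th point sees only that point, while radius `1.1 s` captures all later ones, at least `2N +
1` if `j < M`. The bounds `< 2w` and `> 2Nw` survive weak perturbation and small shifts of the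
centre. The uncontrolled last `2N + 1` points have a negligible share of the mass for large `M`. -/

namespace RadonMeasure

variable {d : ℕ}

/-- Every locally finite measure on Euclidean space is Radon. -/
def ofLocallyFinite (μ : Measure (EuclideanSpace ℝ (Fin d))) [IsLocallyFiniteMeasure μ] :
    RadonMeasure d :=
  ⟨μ, inferInstance⟩

/-! ### Weak convergence and semicontinuity of mass -/

theorem tendsto_iff_integral {ι : Type*} {l : Filter ι} {f : ι → RadonMeasure d}
    {μ : RadonMeasure d} :
    Tendsto f l (𝓝 μ) ↔ ∀ φ : C_c(EuclideanSpace ℝ (Fin d), ℝ),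
      Tendsto (fun i => ∫ x, φ x ∂(f i).toMeasure) l (𝓝 (∫ x, φ x ∂μ.toMeasure)) := by
  rw [(Topology.IsInducing.mk rfl :
    Topology.IsInducing (fun (μ : RadonMeasure d) (φ : C_c(EuclideanSpace ℝ (Fin d), ℝ)) =>
      ∫ x, φ x ∂μ.toMeasure)).tendsto_nhds_iff, tendsto_pi_nhds]
  rfl

theorem tendsto_integral_nhds (μ : RadonMeasure d) (φ : C_c(EuclideanSpace ℝ (Fin d), ℝ)) :
    Tendsto (fun ν : RadonMeasure d => ∫ x, φ x ∂ν.toMeasure) (𝓝 μ)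
      (𝓝 (∫ x, φ x ∂μ.toMeasure)) :=
  tendsto_iff_integral.1 (tendsto_id (x := 𝓝 μ)) φ

/-- A Urysohn function lies between the two indicators. With regularity this yields upper
semicontinuity of mass on compact sets and lower semicontinuity on open sets. -/
theorem exists_bump {K U : Set (EuclideanSpace ℝ (Fin d))} (hK : IsCompact K) (hU : IsOpen U)
    (hKU : K ⊆ U) : ∃ φ : C_c(EuclideanSpace ℝ (Fin d), ℝ), ∀ μ : RadonMeasure d,
      μ.toMeasure K ≤ ENNReal.ofReal (∫ x, φ x ∂μ.toMeasure) ∧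
      ENNReal.ofReal (∫ x, φ x ∂μ.toMeasure) ≤ μ.toMeasure U := by
  obtain ⟨f, hf1, hfc, hfU, hf01⟩ :=
    exists_continuousMap_one_of_isCompact_subset_isOpen hK hU hKU
  refine ⟨⟨f, hfc⟩, fun μ => ?_⟩
  have := μ.regular
  have hint : Integrable f μ.toMeasure := f.continuous.integrable_of_hasCompactSupport hfc
  have heq : ENNReal.ofReal (∫ x, f x ∂μ.toMeasure) = ∫⁻ x, ENNReal.ofReal (f x) ∂μ.toMeasure :=
    ofReal_integral_eq_lintegral_ofReal hint (Eventually.of_forall fun x => (hf01 x).1)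
  change _ ≤ ENNReal.ofReal (∫ x, f x ∂μ.toMeasure) ∧
    ENNReal.ofReal (∫ x, f x ∂μ.toMeasure) ≤ _
  rw [heq]
  constructor
  · rw [← lintegral_indicator_one hK.measurableSet]
    refine lintegral_mono fun x => ?_
    by_cases hx : x ∈ K
    · simp [hx, hf1 hx]
    · simp [hx]
  · rw [← lintegral_indicator_one hU.measurableSet]
    refine lintegral_mono fun x => ?_
    by_cases hx : x ∈ U
    · simpa [hx] using (hf01 x).2
    · have : f x = 0 := image_eq_zero_of_notMem_tsupport fun h => hx (hfU h)
      simp [this]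

theorem eventually_measure_lt_of_isCompact (ν : RadonMeasure d)
    {K : Set (EuclideanSpace ℝ (Fin d))} (hK : IsCompact K) {c : ℝ≥0∞}
    (h : ν.toMeasure K < c) : ∀ᶠ μ in 𝓝 ν, μ.toMeasure K < c := by
  have := ν.regular
  obtain ⟨U, hKU, hU, hUc⟩ := K.exists_isOpen_lt_of_lt c h
  obtain ⟨φ, hφ⟩ := exists_bump hK hU hKU
  have ht := (ENNReal.continuous_ofReal.tendsto _).comp (tendsto_integral_nhds ν φ)
  filter_upwards [ht.eventually_lt_const ((hφ ν).2.trans_lt hUc)] with μ hμ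
  exact (hφ μ).1.trans_lt hμ

theorem eventually_lt_measure_of_isOpen (ν : RadonMeasure d)
    {U : Set (EuclideanSpace ℝ (Fin d))} (hU : IsOpen U) {c : ℝ≥0∞}
    (h : c < ν.toMeasure U) : ∀ᶠ μ in 𝓝 ν, c < μ.toMeasure U := by
  have := ν.regular
  obtain ⟨K, hKU, hK, hcK⟩ := hU.exists_lt_isCompact h
  obtain ⟨φ, hφ⟩ := exists_bump hK hU hKU
  have ht := (ENNReal.continuous_ofReal.tendsto _).comp (tendsto_integral_nhds ν φ)
  filter_upwards [ht.eventually_const_lt (hcK.trans_le (hφ ν).1)] with μ hμ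
  exact hμ.trans_le (hφ μ).2

/-- The finitely supported measure with mass `a i` at the point `p i`, for `i ∈ s`. -/
noncomputable def atomic {ι : Type*} (s : Finset ι) (a : ι → NNReal)
    (p : ι → EuclideanSpace ℝ (Fin d)) : RadonMeasure d :=
  haveI : IsFiniteMeasure (∑ i ∈ s, a i • Measure.dirac (p i)) :=
    ⟨by simp⟩
  ofLocallyFinite (∑ i ∈ s, a i • Measure.dirac (p i))

theorem integral_atomic {ι : Type*} (s : Finset ι) (a : ι → NNReal)
    (p : ι → EuclideanSpace ℝ (Fin d)) (φ : C_c(EuclideanSpace ℝ (Fin d), ℝ)) :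
    ∫ x, φ x ∂(atomic s a p).toMeasure = ∑ i ∈ s, a i * φ (p i) := by
  change ∫ x, φ x ∂(∑ i ∈ s, a i • Measure.dirac (p i)) = _
  rw [integral_finsetSum_measure (f := fun x => φ x) fun i _ =>
    φ.continuous.integrable_of_hasCompactSupport φ.hasCompactSupport]
  refine Finset.sum_congr rfl fun i _ => ?_
  rw [integral_smul_nnreal_measure, integral_dirac, NNReal.smul_def, smul_eq_mul]

theorem atomic_apply {ι : Type*} (s : Finset ι) (a : ι → NNReal)
    (p : ι → EuclideanSpace ℝ (Fin d)) {A : Set (EuclideanSpace ℝ (Fin d))}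
    [DecidablePred fun i => p i ∈ A] (hA : MeasurableSet A) :
    (atomic s a p).toMeasure A = ∑ i ∈ s with p i ∈ A, (a i : ℝ≥0∞) := by
  change (∑ i ∈ s, a i • Measure.dirac (p i)) A = _
  rw [Measure.finsetSum_apply, Finset.sum_filter]
  refine Finset.sum_congr rfl fun i _ => ?_
  rw [Measure.smul_apply, Measure.dirac_apply' _ hA]
  by_cases h : p i ∈ A <;> simp [h, ENNReal.smul_def]

/-! ### Slow sets and the doubling condition -/

/-- The set of points where the measure fails to grow by more than a factor `N` when a radius
below `1 / (N + 1)` is doubled. -/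
def slowSet (μ : RadonMeasure d) (N : ℕ) : Set (EuclideanSpace ℝ (Fin d)) :=
  {x | ∀ r : ℝ, 0 < r → r < 1 / ((N : ℝ) + 1) →
    μ.toMeasure (Metric.closedBall x (2 * r)) ≤ N * μ.toMeasure (Metric.closedBall x r)}

theorem slowSet_mono (μ : RadonMeasure d) : Monotone μ.slowSet := by
  intro M N h x hx r hr hr'
  refine (hx r hr (hr'.trans_le ?_)).trans ?_
  · gcongr
  · gcongr

theorem DoublingAt.exists_mem_slowSet {μ : RadonMeasure d} {x : EuclideanSpace ℝ (Fin d)}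
    (h : μ.DoublingAt x) : ∃ N : ℕ, x ∈ Metric.closedBall 0 (N : ℝ) ∩ μ.slowSet N := by
  have := μ.regular
  obtain ⟨C, hC, hCtop⟩ := exists_between h
  have hev := eventually_lt_of_limsup_lt hC
  obtain ⟨δ, hδ, hsub⟩ := mem_nhdsGT_iff_exists_Ioo_subset.1 hev
  obtain ⟨N₁, hN₁⟩ := ENNReal.exists_nat_gt hCtop.ne
  obtain ⟨N₂, hN₂⟩ := exists_nat_gt ‖x‖
  obtain ⟨N₃, hN₃⟩ := exists_nat_one_div_lt (show (0 : ℝ) < δ from hδ)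
  -- `N₁` bounds the quotient, `N₂` the norm and `N₃` the admissible radii.
  refine ⟨N₁ + N₂ + N₃, ?_, fun r hr hr' => ?_⟩
  · rw [mem_closedBall_zero_iff]
    push_cast
    have : (0 : ℝ) ≤ N₁ := by positivity
    have : (0 : ℝ) ≤ N₃ := by positivity
    linarith
  · have hle : 1 / (((N₁ + N₂ + N₃ : ℕ) : ℝ) + 1) ≤ 1 / ((N₃ : ℝ) + 1) := by
      have : (N₃ : ℝ) ≤ ((N₁ + N₂ + N₃ : ℕ) : ℝ) := by exact_mod_cast Nat.le_add_left _ _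
      gcongr
    have hq := hsub ⟨hr, hr'.trans_le (hle.trans hN₃.le)⟩
    have hfin : μ.toMeasure (Metric.closedBall x r) ≠ ∞ :=
      (isCompact_closedBall x r).measure_lt_top.ne
    have hCN : C ≤ ((N₁ + N₂ + N₃ : ℕ) : ℝ≥0∞) :=
      hN₁.le.trans (by exact_mod_cast (by omega : N₁ ≤ N₁ + N₂ + N₃))
    -- The smaller ball may be null: a finite bound on the quotient then forces the larger one to be
    -- null too.
    refine (ENNReal.div_le_iff_le_mul (Or.inr (ENNReal.natCast_ne_top _)) (Or.inl hfin)).1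
      ((le_of_lt hq).trans hCN)

theorem nonDoubling_of_forall_measure_slowSet_lt {μ : RadonMeasure d}
    (h : ∀ N : ℕ, μ.toMeasure (Metric.closedBall 0 (N : ℝ) ∩ μ.slowSet N) < ((N : ℝ≥0∞) + 1)⁻¹) :
    μ.NonDoubling := by
  have hzero : ∀ N : ℕ, μ.toMeasure (Metric.closedBall 0 (N : ℝ) ∩ μ.slowSet N) = 0 := by
    intro N
    have hlim : Tendsto (fun M : ℕ => ((M : ℝ≥0∞) + 1)⁻¹) atTop (𝓝 0) := by
      simpa using (tendsto_add_atTop_iff_nat 1).2 ENNReal.tendsto_inv_nat_nhds_zero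
    refine le_antisymm (ge_of_tendsto hlim ?_) bot_le
    filter_upwards [eventually_ge_atTop N] with M hM
    · refine (measure_mono (Set.inter_subset_inter ?_ (μ.slowSet_mono hM))).trans (h M).le
      exact Metric.closedBall_subset_closedBall (by exact_mod_cast hM)
  have hnull : μ.toMeasure (⋃ N : ℕ, Metric.closedBall 0 (N : ℝ) ∩ μ.slowSet N) = 0 :=
    measure_iUnion_null hzero
  rw [NonDoubling, ae_iff]
  refine measure_mono_null (fun x hx => ?_) hnull
  rw [Set.mem_iUnion]
  exact DoublingAt.exists_mem_slowSet (not_not.1 hx)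

/-! ### Density of finite atomic measures -/

/-- Finite measures with distinct atoms of positive mass are dense among Radon measures. -/
theorem mem_closure_atomic (μ : RadonMeasure d) :
    μ ∈ closure {ν | ∃ (s : Finset (EuclideanSpace ℝ (Fin d)))
      (a : EuclideanSpace ℝ (Fin d) → NNReal), (∀ x ∈ s, 0 < a x) ∧ ν = atomic s a id} := by
  have := μ.regular
  have hfin : ∀ n : ℕ, IsFiniteMeasure (μ.toMeasure.restrict (Metric.closedBall 0 (n : ℝ))) :=
    fun n => isFiniteMeasure_restrict.2 (isCompact_closedBall _ _).measure_lt_top.ne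
  have hlim : Tendsto (fun n : ℕ => ofLocallyFinite
      (μ.toMeasure.restrict (Metric.closedBall 0 (n : ℝ)))) atTop (𝓝 μ) := by
    refine tendsto_iff_integral.2 fun φ => tendsto_const_nhds.congr' ?_
    obtain ⟨R, hR⟩ := φ.hasCompactSupport.isCompact.isBounded.subset_closedBall 0
    obtain ⟨m, hm⟩ := exists_nat_ge R
    filter_upwards [eventually_ge_atTop m] with n hn
    refine (setIntegral_eq_integral_of_forall_compl_eq_zero fun x hx => ?_).symm
    refine image_eq_zero_of_notMem_tsupport fun hxs => hx ?_
    exact Metric.closedBall_subset_closedBall (hm.trans (by exact_mod_cast hn)) (hR hxs)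
  rw [← closure_closure]
  refine mem_closure_of_tendsto hlim (Eventually.of_forall fun n => ?_)
  set ν := μ.toMeasure.restrict (Metric.closedBall 0 (n : ℝ))
  -- Pushing `ν` forward along simple functions that tend to the identity gives atomic measures
  -- converging to `ν`.
  let f : ℕ → SimpleFunc (EuclideanSpace ℝ (Fin d)) (EuclideanSpace ℝ (Fin d)) :=
    SimpleFunc.approxOn id measurable_id Set.univ 0 (Set.mem_univ _)
  have hf : ∀ x, Tendsto (fun k => f k x) atTop (𝓝 x) := fun x =>
    SimpleFunc.tendsto_approxOn measurable_id (Set.mem_univ _) (by simp)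
  let a : ℕ → EuclideanSpace ℝ (Fin d) → NNReal := fun k y => (ν (f k ⁻¹' {y})).toNNReal
  have hint : ∀ k (φ : C_c(EuclideanSpace ℝ (Fin d), ℝ)),
      ∫ x, φ x ∂(atomic ((f k).range.filter fun y => 0 < a k y) (a k) id).toMeasure =
        ∫ x, φ (f k x) ∂ν := by
    intro k φ
    rw [integral_atomic, Finset.sum_filter_of_ne]
    · have hsum : ∀ x, φ (f k x) =
          ∑ y ∈ (f k).range, (f k ⁻¹' {y}).indicator (fun _ => φ y) x := by
        intro x
        rw [Finset.sum_eq_single (f k x)]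
        · simp
        · intro y _ hy
          exact Set.indicator_of_notMem (fun h => hy (by simpa using h.symm)) _
        · intro h
          exact absurd (SimpleFunc.mem_range_self _ _) h
      simp_rw [hsum]
      rw [integral_finsetSum]
      · refine Finset.sum_congr rfl fun y _ => ?_
        rw [integral_indicator ((f k).measurableSet_fiber y), setIntegral_const, smul_eq_mul]
        rfl
      · intro y _
        exact (integrable_const _).indicator ((f k).measurableSet_fiber y)
    · intro y _ hy
      refine pos_iff_ne_zero.2 fun h => hy ?_
      simp [h]
  refine mem_closure_of_tendsto (f := fun k => atomic ((f k).range.filter fun y => 0 < a k y)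
    (a k) id) (b := atTop) (tendsto_iff_integral.2 fun φ => ?_)
    (Eventually.of_forall fun k => ⟨_, a k, fun x hx => (Finset.mem_filter.1 hx).2, rfl⟩)
  simp_rw [hint]
  obtain ⟨C, hC⟩ := φ.hasCompactSupport.exists_bound_of_continuous φ.continuous
  refine tendsto_integral_of_dominated_convergence (fun _ => C) (fun k => ?_)
    (integrable_const _) (fun k => Eventually.of_forall fun x => hC _)
    (Eventually.of_forall fun x => (φ.continuous.tendsto x).comp (hf x))
  exact (φ.continuous.measurable.comp (f k).measurable).aestronglyMeasurable

/-! ### Geometric clusters -/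

/-- The `j`-th point of a cluster of scale `θ` in direction `e` accumulating at `x`. -/
noncomputable def clusterPt (e : EuclideanSpace ℝ (Fin d)) (θ : ℝ)
    (q : EuclideanSpace ℝ (Fin d) × ℕ) : EuclideanSpace ℝ (Fin d) :=
  q.1 + (θ * (1 / 4) ^ q.2) • e

theorem tendsto_clusterPt (e : EuclideanSpace ℝ (Fin d)) (q : EuclideanSpace ℝ (Fin d) × ℕ) :
    Tendsto (fun θ => clusterPt e θ q) (𝓝[>] 0) (𝓝 q.1) := by
  have : Continuous fun θ => clusterPt e θ q := by
    unfold clusterPt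
    fun_prop
  simpa [clusterPt] using (this.tendsto 0).mono_left nhdsWithin_le_nhds

theorem dist_clusterPt_same {e : EuclideanSpace ℝ (Fin d)} (he : ‖e‖ = 1) (θ : ℝ)
    (x : EuclideanSpace ℝ (Fin d)) (i j : ℕ) :
    dist (clusterPt e θ (x, i)) (clusterPt e θ (x, j)) =
      |θ * (1 / 4) ^ i - θ * (1 / 4) ^ j| := by
  rw [clusterPt, clusterPt, dist_add_left, dist_eq_norm, ← sub_smul, norm_smul, he, mul_one,
    Real.norm_eq_abs]

theorem dist_clusterPt_left {e : EuclideanSpace ℝ (Fin d)} (he : ‖e‖ = 1) {θ : ℝ} (hθ : 0 < θ)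
    (q : EuclideanSpace ℝ (Fin d) × ℕ) : dist (clusterPt e θ q) q.1 ≤ θ := by
  rw [clusterPt, dist_self_add_left, norm_smul, he, mul_one, Real.norm_eq_abs,
    abs_of_pos (by positivity)]
  exact mul_le_of_le_one_right hθ.le (pow_le_one₀ (by norm_num) (by norm_num))

theorem scale_le_of_lt {θ : ℝ} (hθ : 0 < θ) {i j : ℕ} (h : j < i) :
    θ * (1 / 4) ^ i ≤ θ * (1 / 4) ^ j / 4 := by
  have : ((1 : ℝ) / 4) ^ i ≤ (1 / 4) ^ (j + 1) :=
    pow_le_pow_of_le_one (by norm_num) (by norm_num) h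
  rw [pow_succ] at this
  nlinarith

/-- Near its `j`-th point, a cluster of well separated points consists of this point only. -/
theorem eq_of_clusterPt_mem_closedBall {e : EuclideanSpace ℝ (Fin d)} (he : ‖e‖ = 1) {θ ρ : ℝ}
    (hθ : 0 < θ) (hρ : 3 * θ < ρ) {p q : EuclideanSpace ℝ (Fin d) × ℕ}
    (hpq : p.1 ≠ q.1 → ρ ≤ dist p.1 q.1)
    (h : clusterPt e θ p ∈ Metric.closedBall (clusterPt e θ q) (7 / 10 * (θ * (1 / 4) ^ q.2))) :
    p = q := by
  obtain ⟨x, i⟩ := p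
  obtain ⟨y, j⟩ := q
  rw [Metric.mem_closedBall] at h
  simp only at h hpq
  have hs : 0 < θ * (1 / 4) ^ j := by positivity
  have hsθ : θ * (1 / 4) ^ j ≤ θ :=
    mul_le_of_le_one_right hθ.le (pow_le_one₀ (by norm_num) (by norm_num))
  have hxy : x = y := by
    by_contra hne
    have h1 := dist_clusterPt_left he hθ (x, i)
    have h2 := dist_clusterPt_left he hθ (y, j)
    have h3 := dist_triangle4 x (clusterPt e θ (x, i)) (clusterPt e θ (y, j)) y
    rw [dist_comm x (clusterPt e θ (x, i))] at h3
    have := hpq hne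
    simp only at h1 h2
    linarith
  subst hxy
  rw [dist_clusterPt_same he, abs_le] at h
  -- Ratio `1/4` puts earlier points at distance at least `3 s` and later ones at least `3/4 s`,
  -- both above `7/10 s`.
  rcases lt_trichotomy i j with hij | hij | hij
  · have := scale_le_of_lt hθ hij
    linarith
  · rw [hij]
  · have := scale_le_of_lt hθ hij
    linarith

theorem clusterPt_mem_ball {e : EuclideanSpace ℝ (Fin d)} (he : ‖e‖ = 1) {θ : ℝ}
    (hθ : 0 < θ) (x : EuclideanSpace ℝ (Fin d)) {i j : ℕ} (hij : j < i) :
    clusterPt e θ (x, i) ∈ Metric.ball (clusterPt e θ (x, j)) (11 / 10 * (θ * (1 / 4) ^ j)) := by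
  have hi : 0 < θ * (1 / 4) ^ i := by positivity
  have := scale_le_of_lt hθ hij
  rw [Metric.mem_ball, dist_clusterPt_same he, abs_lt]
  constructor <;> linarith

/-- Rapid growth of a measure around a point persists at nearby points. -/
theorem notMem_slowSet_of_mem_ball {μ : RadonMeasure d} {N : ℕ} {y x : EuclideanSpace ℝ (Fin d)}
    {s : ℝ} (hs : 0 < s) (hsN : s < 1 / ((N : ℝ) + 1)) {b : ℝ≥0∞}
    (h₁ : μ.toMeasure (Metric.closedBall y (7 / 10 * s)) < b)
    (h₂ : N * b < μ.toMeasure (Metric.ball y (11 / 10 * s)))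
    (hx : x ∈ Metric.ball y (1 / 10 * s)) : x ∉ μ.slowSet N := by
  intro hslow
  rw [Metric.mem_ball] at hx
  -- A shift of the centre by `s/10` is absorbed: `0.6 + 0.1 = 0.7` and `1.1 + 0.1 = 2 * 0.6`.
  refine absurd (hslow (6 / 10 * s) (by linarith) (by linarith)) (not_le.2 ?_)
  calc N * μ.toMeasure (Metric.closedBall x (6 / 10 * s))
      ≤ N * μ.toMeasure (Metric.closedBall y (7 / 10 * s)) := by
        gcongr
        exact Metric.closedBall_subset_closedBall' (by linarith)
    _ ≤ N * b := by gcongr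
    _ < μ.toMeasure (Metric.ball y (11 / 10 * s)) := h₂
    _ ≤ μ.toMeasure (Metric.closedBall x (2 * (6 / 10 * s))) := by
        refine measure_mono (Metric.ball_subset_closedBall.trans
          (Metric.closedBall_subset_closedBall' ?_))
        rw [dist_comm]
        linarith

/-- Finitely many open conditions make small balls around the first `M` points of each cluster avoid
the slow set. What they leave of the big ball is compact and meets only tail atoms, whose mass
`hsum` bounds. -/
theorem eventually_measure_slowSet_lt_of_cluster (N M : ℕ)
    (S : Finset (EuclideanSpace ℝ (Fin d))) (w : EuclideanSpace ℝ (Fin d) → NNReal)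
    (hw : ∀ x ∈ S, 0 < w x)
    (hsum : ∑ x ∈ S, ((2 * N + 1 : ℕ) : ℝ≥0∞) * w x < ((N : ℝ≥0∞) + 1)⁻¹)
    {e : EuclideanSpace ℝ (Fin d)} (he : ‖e‖ = 1) {θ ρ : ℝ} (hθ : 0 < θ) (hρ : 3 * θ < ρ)
    (hθN : θ < 1 / ((N : ℝ) + 1)) (hS : ∀ x ∈ S, ∀ y ∈ S, x ≠ y → ρ ≤ dist x y) :
    ∀ᶠ μ in 𝓝 (atomic (S ×ˢ Finset.range (M + (2 * N + 1))) (fun q => w q.1) (clusterPt e θ)),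
      μ.toMeasure (Metric.closedBall 0 (N : ℝ) ∩ μ.slowSet N) < ((N : ℝ≥0∞) + 1)⁻¹ := by
  classical
  set T := S ×ˢ Finset.range (M + (2 * N + 1))
  set ν := atomic T (fun q => w q.1) (clusterPt e θ)
  set T' := S ×ˢ Finset.range M
  let s : EuclideanSpace ℝ (Fin d) × ℕ → ℝ := fun q => θ * (1 / 4) ^ q.2
  have hs : ∀ q, 0 < s q := fun q => by positivity
  have hsθ : ∀ q, s q ≤ θ := fun q =>
    mul_le_of_le_one_right hθ.le (pow_le_one₀ (by norm_num) (by norm_num))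
  have hsmall : ∀ q ∈ T', ∀ᶠ μ in 𝓝 ν,
      μ.toMeasure (Metric.closedBall (clusterPt e θ q) (7 / 10 * s q)) < 2 * (w q.1 : ℝ≥0∞) := by
    intro q hq
    have hq1 := (Finset.mem_product.1 hq).1
    have hwq : (w q.1 : ℝ≥0∞) ≠ 0 := by exact_mod_cast (hw _ hq1).ne'
    refine eventually_measure_lt_of_isCompact ν (isCompact_closedBall _ _) ?_
    have hle : ν.toMeasure (Metric.closedBall (clusterPt e θ q) (7 / 10 * s q)) ≤ w q.1 := by
      rw [atomic_apply _ _ _ Metric.isClosed_closedBall.measurableSet]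
      refine (Finset.sum_le_sum_of_subset (t := {q}) fun p hp => ?_).trans (by simp)
      rw [Finset.mem_filter] at hp
      exact Finset.mem_singleton.2 (eq_of_clusterPt_mem_closedBall he hθ hρ
        (hS _ (Finset.mem_product.1 hp.1).1 _ hq1) hp.2)
    refine hle.trans_lt ?_
    rw [two_mul]
    exact ENNReal.lt_add_right ENNReal.coe_ne_top hwq
  have hlarge : ∀ q ∈ T', ∀ᶠ μ in 𝓝 ν,
      N * (2 * (w q.1 : ℝ≥0∞)) <
        μ.toMeasure (Metric.ball (clusterPt e θ q) (11 / 10 * s q)) := by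
    rintro ⟨x, j⟩ hq
    rw [Finset.mem_product, Finset.mem_range] at hq
    refine eventually_lt_measure_of_isOpen ν Metric.isOpen_ball ?_
    have hle : ((2 * N + 1 : ℕ) : ℝ≥0∞) * w x ≤
        ν.toMeasure (Metric.ball (clusterPt e θ (x, j)) (11 / 10 * s (x, j))) := by
      rw [atomic_apply _ _ _ Metric.isOpen_ball.measurableSet]
      calc ((2 * N + 1 : ℕ) : ℝ≥0∞) * w x
          = ∑ q ∈ ({x} : Finset _) ×ˢ Finset.Ioc j (j + (2 * N + 1)), (w q.1 : ℝ≥0∞) := by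
            rw [Finset.sum_product]
            simp
        _ ≤ _ := by
            refine Finset.sum_le_sum_of_subset ?_
            rintro ⟨y, i⟩ hp
            rw [Finset.mem_product, Finset.mem_singleton, Finset.mem_Ioc] at hp
            obtain ⟨rfl, hi⟩ := hp
            refine Finset.mem_filter.2 ⟨Finset.mem_product.2 ⟨hq.1, Finset.mem_range.2 ?_⟩,
              clusterPt_mem_ball he hθ _ hi.1⟩
            have := hq.2
            simp only at this hi ⊢
            omega
    refine lt_of_lt_of_le ?_ hle
    have hpos := hw x hq.1
    have : (N : NNReal) * (2 * w x) < ((2 * N + 1 : ℕ) : NNReal) * w x := by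
      push_cast
      rw [add_mul, one_mul, mul_left_comm, ← mul_assoc]
      exact lt_add_of_pos_right _ hpos
    exact_mod_cast this
  have hrest : ∀ᶠ μ in 𝓝 ν, μ.toMeasure (Metric.closedBall 0 (N : ℝ) \
      ⋃ q ∈ T', Metric.ball (clusterPt e θ q) (1 / 10 * s q)) < ((N : ℝ≥0∞) + 1)⁻¹ := by
    have hopen : IsOpen (⋃ q ∈ T', Metric.ball (clusterPt e θ q) (1 / 10 * s q)) :=
      isOpen_biUnion fun _ _ => Metric.isOpen_ball
    refine eventually_measure_lt_of_isCompact ν ((isCompact_closedBall _ _).diff hopen) ?_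
    refine lt_of_le_of_lt ?_ hsum
    rw [atomic_apply _ _ _ (Metric.isClosed_closedBall.measurableSet.diff hopen.measurableSet)]
    calc _ ≤ ∑ q ∈ S ×ˢ Finset.Ico M (M + (2 * N + 1)), (w q.1 : ℝ≥0∞) := by
          refine Finset.sum_le_sum_of_subset ?_
          rintro ⟨x, j⟩ hp
          obtain ⟨hpT, -, hp⟩ := Finset.mem_filter.1 hp
          rw [Finset.mem_product, Finset.mem_range] at hpT
          refine Finset.mem_product.2 ⟨hpT.1, Finset.mem_Ico.2 ⟨?_, hpT.2⟩⟩
          by_contra hj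
          refine hp (Set.mem_biUnion (x := (x, j))
            (Finset.mem_product.2 ⟨hpT.1, Finset.mem_range.2 (not_le.1 hj)⟩) ?_)
          exact Metric.mem_ball_self (mul_pos (by norm_num) (hs _))
      _ = _ := by
          rw [Finset.sum_product]
          simp
  filter_upwards [(Finset.eventually_all T').2 hsmall, (Finset.eventually_all T').2 hlarge,
    hrest] with μ h1 h2 h3
  refine (measure_mono ?_).trans_lt h3
  rintro x ⟨hx, hslow⟩
  refine ⟨hx, fun hmem => ?_⟩
  obtain ⟨q, hq, hxq⟩ := Set.mem_iUnion₂.1 hmem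
  exact notMem_slowSet_of_mem_ball (hs q) ((hsθ q).trans_lt hθN) (h1 q hq) (h2 q hq) hxq hslow

/-! ### Density of the open conditions -/

theorem exists_pos_le_dist (S : Finset (EuclideanSpace ℝ (Fin d))) :
    ∃ ρ : ℝ, 0 < ρ ∧ ∀ x ∈ S, ∀ y ∈ S, x ≠ y → ρ ≤ dist x y := by
  have : ∀ᶠ ρ : ℝ in 𝓝[>] 0, ∀ x ∈ S, ∀ y ∈ S, x ≠ y → ρ ≤ dist x y := by
    refine (Finset.eventually_all S).2 fun x _ => (Finset.eventually_all S).2 fun y _ => ?_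
    by_cases hxy : x = y
    · simp [hxy]
    · filter_upwards [nhdsWithin_le_nhds (Iic_mem_nhds (dist_pos.2 hxy))] with ρ hρ _ using hρ
  obtain ⟨ρ, hρ, hρ0⟩ := (this.and self_mem_nhdsWithin).exists
  exact ⟨ρ, hρ0, hρ⟩

theorem dense_interior_measure_slowSet_lt (hd : 1 ≤ d) (N : ℕ) :
    Dense (interior {μ : RadonMeasure d |
      μ.toMeasure (Metric.closedBall 0 (N : ℝ) ∩ μ.slowSet N) < ((N : ℝ≥0∞) + 1)⁻¹}) := by
  intro μ
  refine closure_minimal ?_ isClosed_closure (mem_closure_atomic μ)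
  rintro _ ⟨S, a, ha, rfl⟩
  obtain ⟨ρ, hρ, hS⟩ := exists_pos_le_dist S
  have : Nonempty (Fin d) := ⟨⟨0, hd⟩⟩
  -- A unit direction exists because `1 ≤ d`.
  obtain ⟨e, he⟩ := exists_norm_eq (EuclideanSpace ℝ (Fin d)) zero_le_one
  -- With `K` points per cluster the tails weigh `(2N + 1) ∑ a / K`; this `M` brings that below `1 /
  -- (N + 1)`.
  obtain ⟨M, hM⟩ := exists_nat_gt (((2 * N + 1 : ℕ) : NNReal) * (∑ x ∈ S, a x) * (N + 1))
  let K : NNReal := ((M + (2 * N + 1) : ℕ) : NNReal)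
  have hK : 0 < K := by
    simp only [K]
    positivity
  have hMK : (M : NNReal) ≤ K := by
    simp only [K]
    exact_mod_cast Nat.le_add_right _ _
  have hsum : ∑ x ∈ S, ((2 * N + 1 : ℕ) : ℝ≥0∞) * ((a x / K : NNReal) : ℝ≥0∞) <
      ((N : ℝ≥0∞) + 1)⁻¹ := by
    have : ∑ x ∈ S, ((2 * N + 1 : ℕ) : NNReal) * (a x / K) < ((N : NNReal) + 1)⁻¹ := by
      rw [← Finset.mul_sum, ← Finset.sum_div, ← mul_div_assoc, div_lt_iff₀ hK, inv_mul_eq_div,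
        lt_div_iff₀ (by positivity)]
      exact hM.trans_le hMK
    rw [← ENNReal.coe_lt_coe, ENNReal.coe_inv (by positivity)] at this
    simpa only [ENNReal.ofNNReal_finsetSum, ENNReal.coe_mul, ENNReal.coe_natCast, ENNReal.coe_add,
      ENNReal.coe_one] using this
  refine mem_closure_of_tendsto (f := fun θ : ℝ => atomic
    (S ×ˢ Finset.range (M + (2 * N + 1))) (fun q => a q.1 / K) (clusterPt e θ))
    (b := 𝓝[>] 0) (tendsto_iff_integral.2 fun φ => ?_) ?_
  · simp_rw [integral_atomic]
    have hlim : Tendsto (fun θ => ∑ q ∈ S ×ˢ Finset.range (M + (2 * N + 1)),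
        ((a q.1 / K : NNReal) : ℝ) * φ (clusterPt e θ q)) (𝓝[>] 0)
        (𝓝 (∑ q ∈ S ×ˢ Finset.range (M + (2 * N + 1)), ((a q.1 / K : NNReal) : ℝ) * φ q.1)) :=
      tendsto_finsetSum _ fun q _ =>
        ((φ.continuous.tendsto _).comp (tendsto_clusterPt e q)).const_mul _
    convert hlim using 2
    rw [Finset.sum_product]
    refine Finset.sum_congr rfl fun x _ => ?_
    have hK' : (K : ℝ) ≠ 0 := by exact_mod_cast hK.ne'
    have hK'' : (K : ℝ) = ((M + (2 * N + 1) : ℕ) : ℝ) := by simp [K]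
    simp only
    rw [Finset.sum_const, Finset.card_range, nsmul_eq_mul, ← hK'', NNReal.coe_div, id]
    field_simp
  · have h1 : ∀ᶠ θ : ℝ in 𝓝[>] 0, θ < 1 / ((N : ℝ) + 1) :=
      nhdsWithin_le_nhds (Iio_mem_nhds (by positivity))
    have h2 : ∀ᶠ θ : ℝ in 𝓝[>] 0, θ < ρ / 3 :=
      nhdsWithin_le_nhds (Iio_mem_nhds (by positivity))
    filter_upwards [h1, h2, self_mem_nhdsWithin] with θ hθN hθρ hθ
    exact mem_interior_iff_mem_nhds.2 (eventually_measure_slowSet_lt_of_cluster N M S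
      (fun x => a x / K) (fun x hx => div_pos (ha x hx) hK) hsum he hθ (by linarith) hθN hS)

end RadonMeasure

theorem corollary4p1 (d : ℕ) (hd : 1 ≤ d) :
    IsTypical (fun μ : RadonMeasure d => μ.NonDoubling) := by
  let W : ℕ → Set (RadonMeasure d) := fun N => {μ |
    μ.toMeasure (Metric.closedBall 0 (N : ℝ) ∩ μ.slowSet N) < ((N : ℝ≥0∞) + 1)⁻¹}
  have hmem : ⋂ N, interior (W N) ∈ residual (RadonMeasure d) :=
    countable_iInter_mem.2 fun N => residual_of_dense_open isOpen_interior
      (RadonMeasure.dense_interior_measure_slowSet_lt hd N)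
  rw [IsTypical, IsMeagre, compl_compl]
  refine mem_of_superset hmem fun μ hμ => ?_
  exact RadonMeasure.nonDoubling_of_forall_measure_slowSet_lt fun N =>
    interior_subset (s := W N) (Set.mem_iInter.1 hμ N)
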